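/- Let $H(t)=\sum_{m=-M}^{M}H_m e^{-im\omega t}$, $\omega=2\pi/T$, $T>0$, be a time-periodic Hamiltonian on a finite-dimensional complex Hilbert space $\mathcal H$, with $H_m^\dagger=H_{-m}$ and $\|H_m\|\le\alpha$ for all $m$. A real number $\epsilon$ is a quasienergy of $H(t)$ if $i\,\partial_t|\psi(t)\rangle=H(t)|\psi(t)\rangle$ has a nonzero solution $e^{-i\epsilon t}|\phi(t)\rangle$ with $|\phi(t+T)\rangle=|\phi(t)\rangle$. For $l\in\mathbb Z$ put $\mathrm{BZ}_l=[(-l-1/2)\omega,(-l+1/2)\omega)$. For $L\in\mathbb N$ let $[L]=\{-L+1,\dots,L\}$, and let $$H_{\mathrm F}^L=\sum_{|m|\le M}\ \sum_{l\in[L];\,l+m\in[L]}|l+m\rangle\langle l|\otimes H_m-\sum_{l\in[L]}l\omega|l\rangle\langle l|\otimes I$$ be the truncated Floquet Hamiltonian on $\mathbb C^{[L]}\otimes\mathcal H$. Put $\alpha_{\mathrm F}^L=(2M+1)\alpha+L\omega$ and $b_{\mathrm F}^L=1+\lceil\log_2(2\alpha_{\mathrm F}^L/\omega)\rceil$. For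 every $M\in\mathbb N$ and $K>0$ there is a constant $C>0$, depending only on $M$ and $K$, such that the following holds for all $\mathcal H$, $T$, $\alpha$, $H(t)$ as above, all $\varepsilon,\nu\in(0,1)$, all $l\in\mathbb Z$, and all $b'\in\mathbb N$ with $2^{-b'}\le\varepsilon$ and $b'\le K(1+\log(1/\varepsilon))$. Suppose that $H(t)$ has rounding promise $\nu$ at $b'$ bits, i.e. every quasienergy $\epsilon\in\mathrm{BZ}_0$ satisfies $$\frac{\epsilon}{\omega}\notin\bigcup_{x=-2^{b'-1}}^{2^{b'-1}}\left[\frac{x-\nu/2}{2^{b'}},\frac{x+\nu/2}{2^{b'}}\right),$$ and that $L\in\mathbb N$ satisfies $L\ge C\,(\alpha T+|l|+\log(1/(\varepsilon\nu)))$. Then every eigenvalue $\tilde\epsilon$ of $H_{\mathrm F}^L$ in $\mathrm{BZ}_l$ satisfies $$\frac{\tilde\epsilon}{2^{b_{\mathrm F}^L}\omega}\notin\bigcup_{x=(-l-1/2)2^{b'}}^{(-l+1/2)2^{b'}}\left[\frac{x-\nu/4}{2^{b'+b_{\mathrm F}^L}},\frac{x+\nu/4}{2^{b'+b_{\mathrm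 F}^L}}\right),$$ where both unions run over integers $x$. In other words, at $b'+b_{\mathrm F}^L$ bits, $H_{\mathrm F}^L/(2^{b_{\mathrm F}^L}\omega)$ inherits a rounding promise $\nu/2$ for its eigenvalues in $\mathrm{BZ}_l$. -/

import Mathlib

open scoped InnerProductSpace

/-- A bounded time-periodic Hamiltonian with finitely many Fourier components,
`H(t) = ∑_{|m| ≤ M} H_m e^{-i m ω t}` with `ω = 2π / T`, on a Hilbert space `E`.
The law `symm` says `(H_m)† = H_{-m}`, i.e. every `H(t)` is Hermitian. -/
structure PeriodicHamiltonian (E : Type*) [NormedAddCommGroup E] [InnerProductSpace ℂ E]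
    (M : ℕ) where
  /-- the period `T` -/
  period : ℝ
  period_pos : 0 < period
  /-- the Fourier components `H_m` -/
  comp : ℤ → (E →L[ℂ] E)
  comp_eq_zero : ∀ m : ℤ, (M : ℤ) < |m| → comp m = 0
  symm : ∀ (m : ℤ) (x y : E), ⟪comp m x, y⟫_ℂ = ⟪x, comp (-m) y⟫_ℂ

/-- The Fourier indices `[L] = {-L+1, …, L}` that are kept by the truncation. -/
noncomputable abbrev cutoffIndices (L : ℕ) : Finset ℤ := Finset.Icc (-(L : ℤ) + 1) (L : ℤ)

/-- The truncated Sambe space `ℂ^[L] ⊗ E`, as the Hilbert space of `E`-valued families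
on `[L]`; the component at `l` is the coefficient of `|l⟩`. -/
abbrev TruncSambe (E : Type*) [NormedAddCommGroup E] (L : ℕ) : Type _ :=
  PiLp 2 (fun _ : cutoffIndices L => E)

/-- The union over the integers `x ∈ [lo, hi]` of the width-`ν` rounding intervals
`[(x - ν/2) / 2^b, (x + ν/2) / 2^b)` at `b` bits. -/
def roundingIntervals (lo hi ν : ℝ) (b : ℤ) : Set ℝ :=
  ⋃ x ∈ {x : ℤ | lo ≤ (x : ℝ) ∧ (x : ℝ) ≤ hi},
    Set.Ico (((x : ℝ) - ν / 2) / (2 : ℝ) ^ b) (((x : ℝ) + ν / 2) / (2 : ℝ) ^ b)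

namespace PeriodicHamiltonian

section

variable {E : Type*} [NormedAddCommGroup E] [InnerProductSpace ℂ E] {M : ℕ}

/-- The frequency `ω = 2π / T`. -/
noncomputable def freq (H : PeriodicHamiltonian E M) : ℝ := 2 * Real.pi / H.period

/-- The Hamiltonian `H(t)` at time `t`. -/
noncomputable def at_time (H : PeriodicHamiltonian E M) (t : ℝ) : E →L[ℂ] E :=
  ∑ m ∈ Finset.Icc (-(M : ℤ)) (M : ℤ),
    Complex.exp (-Complex.I * (m : ℂ) * (H.freq : ℂ) * (t : ℂ)) • H.comp m

/-- `e` is a quasienergy: the Schrödinger equation `i ψ' = H(t) ψ` has a nonzero solution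
`ψ(t) = e^{-i e t} φ(t)` with `φ` periodic of period `T`. -/
def IsQuasienergy (H : PeriodicHamiltonian E M) (e : ℝ) : Prop :=
  ∃ φ : ℝ → E, Function.Periodic φ H.period ∧ φ ≠ 0 ∧
    ∀ t : ℝ, HasDerivAt (fun s : ℝ => Complex.exp (-Complex.I * (e : ℂ) * (s : ℂ)) • φ s)
      (-Complex.I • H.at_time t (Complex.exp (-Complex.I * (e : ℂ) * (t : ℂ)) • φ t)) t

/-- The Brillouin zone `BZ_l = [(-l - 1/2) ω, (-l + 1/2) ω)`. -/
noncomputable def brillouinZone (H : PeriodicHamiltonian E M) (l : ℤ) : Set ℝ :=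
  Set.Ico ((-(l : ℝ) - 1 / 2) * H.freq) ((-(l : ℝ) + 1 / 2) * H.freq)

/-- The truncated Floquet Hamiltonian
`H_F^L = ∑_{|m| ≤ M} ∑_{l, l+m ∈ [L]} |l+m⟩⟨l| ⊗ H_m - ∑_{l ∈ [L]} l ω |l⟩⟨l| ⊗ I`:
the component of `H_F^L Ψ` at `k` is `∑_{l ∈ [L]} H_{k-l} Ψ_l - k ω Ψ_k`
(and `H_m = 0` for `|m| > M`). -/
noncomputable def truncFloquet (H : PeriodicHamiltonian E M) (L : ℕ) :
    Module.End ℂ (TruncSambe E L) where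
  toFun Ψ := WithLp.toLp 2 fun k : cutoffIndices L =>
    (∑ l : cutoffIndices L, H.comp ((k : ℤ) - (l : ℤ)) (Ψ l))
      - (((k : ℤ) : ℂ) * (H.freq : ℂ)) • Ψ k
  map_add' Ψ Ψ' := by
    ext k
    simp only [PiLp.add_apply, map_add, Finset.sum_add_distrib, smul_add]
    abel
  map_smul' c Ψ := by
    ext k
    simp only [PiLp.smul_apply, map_smul, RingHom.id_apply, smul_sub, Finset.smul_sum]
    rw [smul_comm]

/-- The time-periodic Hamiltonian has rounding promise `ν` at `b` bits: for every quasienergy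
`e ∈ BZ_0`, the number `e / ω` avoids the width-`ν` rounding intervals centered at `x / 2^b`
with `-2^(b-1) ≤ x ≤ 2^(b-1)`. -/
def HasRoundingPromise (H : PeriodicHamiltonian E M) (ν : ℝ) (b : ℕ) : Prop :=
  ∀ e : ℝ, H.IsQuasienergy e → e ∈ H.brillouinZone 0 →
    e / H.freq ∉ roundingIntervals (-(2 : ℝ) ^ ((b : ℤ) - 1)) ((2 : ℝ) ^ ((b : ℤ) - 1)) ν (b : ℤ)

/-- The energy scale `α_F^L = (2M+1) α + L ω`. -/
noncomputable def normScale (H : PeriodicHamiltonian E M) (α : ℝ) (L : ℕ) : ℝ :=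
  (2 * (M : ℝ) + 1) * α + (L : ℝ) * H.freq

/-- The number of additional bits `b_F^L = 1 + ⌈log₂ (2 α_F^L / ω)⌉`. -/
noncomputable def normBits (H : PeriodicHamiltonian E M) (α : ℝ) (L : ℕ) : ℤ :=
  1 + ⌈Real.logb 2 (2 * H.normScale α L / H.freq)⌉

end

end PeriodicHamiltonian

/-! An eigenvector of the truncated Floquet Hamiltonian, with components `f k`, satisfies (e + kω)
f_k = ∑ H_{k-j} f_j. For e in BZ_l the factor on the left is at least (|k-l| - 1/2)ω, while the
right side sees only 2M+1 neighbours. So `f` decays exponentially once |k-l| exceeds a multiple of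
αT (`IsTruncatedMode.norm_le_exp`).

The function ψ(t) = ∑ e^{-i(e+kω)t} f_k then solves the Schrödinger equation up to a source, the
leakage, fed only by components near the edge of [L], hence exponentially small in L. Over one
period, U(T)ψ(0) ≈ e^{-ieT}ψ(0). As U(T) is unitary, it has an eigenvalue near e^{-ieT}, that is, a
quasienergy e' near e (`exists_isQuasienergy_near`). Here ψ(0) is not small: ‖ψ(t)‖ is nearly
constant and its supremum dominates every `‖f k‖`.

With L as large as assumed, |e' - e| < ων/(4·2^{b'}). Intervals of half-width ν/4 thickened by ν/4
become those of half-width ν/2, so the promise for e', shifted to BZ_0, excludes e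
(`HasRoundingPromise.notMem_roundingIntervals`). -/

/-! ### Fundamental solutions of linear differential equations -/

section DysonSeries

variable {𝔸 : Type*} [NormedRing 𝔸] [NormedAlgebra ℝ 𝔸]

/-- The terms of the Dyson series of the linear equation `U' = A U`, `U 0 = 1`. -/
noncomputable def dysonTerm (A : ℝ → 𝔸) : ℕ → ℝ → 𝔸
  | 0 => fun _ => 1
  | n + 1 => fun t => ∫ s in (0 : ℝ)..t, A s * dysonTerm A n s

theorem continuous_dysonTerm {A : ℝ → 𝔸} (hA : Continuous A) (n : ℕ) :
    Continuous (dysonTerm A n) := by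
  induction n with
  | zero => exact continuous_const
  | succ n ih =>
    exact intervalIntegral.continuous_primitive (fun a b => (hA.mul ih).intervalIntegrable a b) 0

theorem hasDerivAt_dysonTerm_succ [CompleteSpace 𝔸] {A : ℝ → 𝔸} (hA : Continuous A) (n : ℕ)
    (t : ℝ) : HasDerivAt (dysonTerm A (n + 1)) (A t * dysonTerm A n t) t :=
  intervalIntegral.integral_hasDerivAt_right
    ((hA.mul (continuous_dysonTerm hA n)).intervalIntegrable 0 t)
    ((hA.mul (continuous_dysonTerm hA n)).stronglyMeasurableAtFilter _ _)
    (hA.mul (continuous_dysonTerm hA n)).continuousAt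

/-- Each integration contributes a factor B|t|/(n+1). The resulting exponential series is the
majorant for termwise differentiation. -/
theorem norm_dysonTerm_le {A : ℝ → 𝔸} (hA : Continuous A) {B : ℝ} (hB : ∀ t, ‖A t‖ ≤ B)
    (n : ℕ) (t : ℝ) : ‖dysonTerm A n t‖ ≤ ‖(1 : 𝔸)‖ * ((B * |t|) ^ n / n.factorial) := by
  have hB0 : 0 ≤ B := (norm_nonneg _).trans (hB 0)
  induction n generalizing t with
  | zero => simp [dysonTerm]
  | succ n ih =>
    have hc : Continuous fun s => A s * dysonTerm A n s := hA.mul (continuous_dysonTerm hA n)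
    calc ‖dysonTerm A (n + 1) t‖ ≤ ∫ s in Set.uIoc 0 t, ‖A s * dysonTerm A n s‖ :=
          intervalIntegral.norm_integral_le_integral_norm_uIoc
      _ ≤ ∫ s in Set.uIoc 0 t, (‖(1 : 𝔸)‖ * B ^ (n + 1) / n.factorial) * |s - 0| ^ n := by
          refine MeasureTheory.setIntegral_mono
            (intervalIntegrable_iff.1 (hc.norm.intervalIntegrable 0 t))
            (intervalIntegrable_iff.1 (Continuous.intervalIntegrable (by fun_prop) 0 t)) fun s => ?_
          calc ‖A s * dysonTerm A n s‖ ≤ B * (‖(1 : 𝔸)‖ * ((B * |s|) ^ n / n.factorial)) :=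
                (norm_mul_le _ _).trans
                  (mul_le_mul (hB s) (ih s) (norm_nonneg _) hB0)
            _ = _ := by rw [sub_zero, mul_pow, pow_succ]; ring
      _ = ‖(1 : 𝔸)‖ * ((B * |t|) ^ (n + 1) / (n + 1).factorial) := by
          rw [MeasureTheory.integral_const_mul, integral_pow_abs_sub_uIoc, sub_zero,
            Nat.factorial_succ, mul_pow]
          push_cast
          have := Nat.cast_ne_zero (R := ℝ).2 (Nat.factorial_ne_zero n)
          field_simp

/-- A linear differential equation with bounded continuous coefficients has a global
fundamental solution. -/
theorem exists_hasDerivAt_mul [CompleteSpace 𝔸] {A : ℝ → 𝔸} (hA : Continuous A) {B : ℝ}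
    (hB : ∀ t, ‖A t‖ ≤ B) : ∃ U : ℝ → 𝔸, U 0 = 1 ∧ ∀ t, HasDerivAt U (A t * U t) t := by
  have hB0 : 0 ≤ B := (norm_nonneg _).trans (hB 0)
  have hs (t : ℝ) : Summable fun n => dysonTerm A n t :=
    Summable.of_norm_bounded ((Real.summable_pow_div_factorial (B * |t|)).mul_left _)
      fun n => norm_dysonTerm_le hA hB n t
  have hz (n : ℕ) : dysonTerm A (n + 1) 0 = 0 := by simp [dysonTerm]
  refine ⟨fun t => 1 + ∑' n, dysonTerm A (n + 1) t, by simp [hz], fun t => ?_⟩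
  -- The constant zeroth term is split off, so that the n-th term of the remaining series
  -- differentiates to `A` times the n-th Dyson term.
  have h := hasDerivAt_tsum_of_isPreconnected
    (g := fun n => dysonTerm A (n + 1)) (g' := fun n s => A s * dysonTerm A n s)
    (u := fun n => B * (‖(1 : 𝔸)‖ * ((B * (|t| + 1)) ^ n / n.factorial)))
    (((Real.summable_pow_div_factorial _).mul_left _).mul_left _)
    Metric.isOpen_ball (convex_ball (0 : ℝ) (|t| + 1)).isPreconnected
    (fun n s _ => hasDerivAt_dysonTerm_succ hA n s)
    (fun n s hs => by
      have hs' : |s| ≤ |t| + 1 := by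
        have := mem_ball_zero_iff.1 hs
        rw [Real.norm_eq_abs] at this
        exact this.le
      refine (norm_mul_le _ _).trans
        (mul_le_mul (hB s) ((norm_dysonTerm_le hA hB n s).trans ?_) (norm_nonneg _) hB0)
      gcongr)
    (Metric.mem_ball_self (by positivity)) (by simp [hz])
    (show t ∈ Metric.ball (0 : ℝ) (|t| + 1) by simp)
  refine (h.const_add 1).congr_deriv ?_
  have h1 := (hs t).tsum_eq_zero_add
  rw [(hs t).tsum_mul_left, h1]
  rfl

end DysonSeries

/-! ### Approximate eigenvectors of normal operators -/

section ApproximateEigenvector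

theorem Units.isStarNormal_inv {R : Type*} [Monoid R] [StarMul R] (u : Rˣ)
    [hu : IsStarNormal (u : R)] : IsStarNormal (↑u⁻¹ : R) := by
  constructor
  have h : Commute (star u) u := Units.ext (by simpa using hu.star_comm_self.eq)
  have := congrArg Units.val h.inv_inv.eq
  simpa [Commute, SemiconjBy] using this

variable {E : Type*} [NormedAddCommGroup E] [InnerProductSpace ℂ E] [FiniteDimensional ℂ E]

theorem ContinuousLinearMap.exists_eigenvector_of_mem_spectrum [CompleteSpace E] {A : E →L[ℂ] E}
    {z : ℂ} (hz : z ∈ spectrum ℂ A) : ∃ w : E, w ≠ 0 ∧ A w = z • w := by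
  rw [ContinuousLinearMap.spectrum_eq, ← Module.End.hasEigenvalue_iff_mem_spectrum] at hz
  obtain ⟨w, hw⟩ := hz.exists_hasEigenvector
  exact ⟨w, hw.2, hw.apply_eq_smul⟩

/-- An approximate eigenvector of a normal operator forces a nearby eigenvalue. -/
theorem exists_eigenvector_near_of_isStarNormal [CompleteSpace E] (A : E →L[ℂ] E) [IsStarNormal A]
    {μ : ℂ} {v : E} (hv : v ≠ 0) {η : ℝ} (h : ‖A v - μ • v‖ ≤ η * ‖v‖) :
    ∃ z : ℂ, ‖z - μ‖ ≤ η ∧ ∃ w : E, w ≠ 0 ∧ A w = z • w := by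
  have : Nontrivial E := ⟨v, 0, hv⟩
  have hv' : 0 < ‖v‖ := norm_pos_iff.2 hv
  have hη : 0 ≤ η := by
    by_contra hη
    have := (norm_nonneg _).trans h
    nlinarith
  by_cases hμ : μ ∈ spectrum ℂ A
  · exact ⟨μ, by simpa using hη, ContinuousLinearMap.exists_eigenvector_of_mem_spectrum hμ⟩
  -- Here `u` is μ - A. Its inverse is normal, so its norm is attained as |z| for some z in its
  -- spectrum; then μ - z⁻¹ is an eigenvalue of `A`, and applying the inverse to (μ - A)v gives 1 ≤
  -- |z|η.
  obtain ⟨u, hu⟩ := spectrum.notMem_iff.1 hμ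
  have hu' (w : E) : (u : E →L[ℂ] E) w = μ • w - A w := by
    rw [hu]; simp [Algebra.algebraMap_eq_smul_one]
  have : IsStarNormal (u : E →L[ℂ] E) := by
    rw [hu]
    constructor
    have h1 : Commute (star A) A := star_comm_self' A
    rw [star_sub, ← algebraMap_star_comm]
    exact (Algebra.commute_algebraMap_left _ _).sub_left
      ((Algebra.commute_algebraMap_right _ _).sub_right h1)
  have := u.isStarNormal_inv
  obtain ⟨z, hz, hzn⟩ := spectrum.exists_nnnorm_eq_spectralRadius (↑u⁻¹ : E →L[ℂ] E)
  rw [IsStarNormal.spectralRadius_eq_nnnorm] at hzn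
  have hzn' : ‖z‖ = ‖(↑u⁻¹ : E →L[ℂ] E)‖ := congrArg NNReal.toReal (ENNReal.coe_injective hzn)
  have hle : ‖v‖ ≤ ‖z‖ * (η * ‖v‖) := by
    calc ‖v‖ = ‖(↑u⁻¹ : E →L[ℂ] E) ((u : E →L[ℂ] E) v)‖ := by
          rw [← mul_apply_eq_comp, u.inv_mul, one_apply_eq_self]
      _ ≤ ‖(↑u⁻¹ : E →L[ℂ] E)‖ * ‖(u : E →L[ℂ] E) v‖ := ContinuousLinearMap.le_opNorm _ _
      _ ≤ ‖z‖ * (η * ‖v‖) := by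
          rw [hzn', hu', norm_sub_rev]
          gcongr
  have hz0 : 0 < ‖z‖ := by
    rcases (norm_nonneg z).eq_or_lt with h0 | h0
    · rw [← h0] at hle; linarith
    · exact h0
  have hmem := spectrum.inv₀_mem_iff.2 hz
  obtain ⟨w, hw, hAw⟩ := ContinuousLinearMap.exists_eigenvector_of_mem_spectrum hmem
  refine ⟨μ - z⁻¹, ?_, w, hw, ?_⟩
  · rw [sub_sub_cancel_left, norm_neg, norm_inv, inv_le_iff_one_le_mul₀' hz0]
    exact le_of_mul_le_mul_right (by linarith) hv'
  · rw [hu'] at hAw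
    rw [sub_smul, ← hAw, sub_sub_cancel]

end ApproximateEigenvector

/-! ### Unitary propagator, monodromy and quasienergies -/

namespace PeriodicHamiltonian

section Dynamics

variable {E : Type*} [NormedAddCommGroup E] [InnerProductSpace ℂ E] {M : ℕ}

theorem freq_pos (H : PeriodicHamiltonian E M) : 0 < H.freq :=
  div_pos Real.two_pi_pos H.period_pos

theorem freq_mul_period (H : PeriodicHamiltonian E M) : H.freq * H.period = 2 * Real.pi :=
  div_mul_cancel₀ _ H.period_pos.ne'

theorem exp_int_mul_freq_mul_period (H : PeriodicHamiltonian E M) (n : ℤ) :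
    Complex.exp (Complex.I * n * H.freq * H.period) = 1 := by
  have h : (H.freq : ℂ) * H.period = 2 * Real.pi := by exact_mod_cast H.freq_mul_period
  rw [show Complex.I * n * H.freq * H.period = n * (2 * Real.pi * Complex.I) by
    rw [mul_assoc, h]; ring]
  exact Complex.exp_int_mul_two_pi_mul_I n

theorem inner_at_time_left (H : PeriodicHamiltonian E M) (t : ℝ) (x y : E) :
    ⟪H.at_time t x, y⟫_ℂ = ⟪x, H.at_time t y⟫_ℂ := by
  simp only [at_time, sum_apply, sum_inner, inner_sum,
    smul_apply, inner_smul_left, inner_smul_right, H.symm]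
  refine Finset.sum_nbij' (fun m => -m) (fun m => -m) ?_ ?_ ?_ ?_ ?_
  · intro m hm; rw [Finset.mem_Icc] at *; omega
  · intro m hm; rw [Finset.mem_Icc] at *; omega
  · simp
  · simp
  · intro m _
    rw [← Complex.exp_conj]
    simp

theorem continuous_at_time (H : PeriodicHamiltonian E M) : Continuous H.at_time := by
  unfold at_time
  fun_prop

theorem at_time_add_period (H : PeriodicHamiltonian E M) (t : ℝ) :
    H.at_time (t + H.period) = H.at_time t := by
  refine Finset.sum_congr rfl fun m _ => ?_
  have h := H.exp_int_mul_freq_mul_period (-m)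
  push_cast at h ⊢
  rw [show -Complex.I * m * H.freq * (t + H.period)
    = -Complex.I * m * H.freq * t + Complex.I * -m * H.freq * H.period by ring, Complex.exp_add, h,
    mul_one]

theorem norm_exp_neg_I_mul (a b c : ℝ) : ‖Complex.exp (-Complex.I * a * b * c)‖ = 1 := by
  rw [show -Complex.I * a * b * c = ((-a * b * c : ℝ) : ℂ) * Complex.I by push_cast; ring]
  exact Complex.norm_exp_ofReal_mul_I _

theorem norm_at_time_le (H : PeriodicHamiltonian E M) (t : ℝ) :
    ‖H.at_time t‖ ≤ ∑ m ∈ Finset.Icc (-(M : ℤ)) (M : ℤ), ‖H.comp m‖ := by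
  refine (norm_sum_le _ _).trans (Finset.sum_le_sum fun m _ => ?_)
  rw [norm_smul]
  have := norm_exp_neg_I_mul m H.freq t
  push_cast at this
  rw [this, one_mul]

/-- Along two solutions of the driven Schrödinger equation only the driving terms change the
inner product. -/
theorem hasDerivAt_inner_solutions (H : PeriodicHamiltonian E M) {f g : ℝ → E} {a b : E} {t : ℝ}
    (hf : HasDerivAt f (-Complex.I • H.at_time t (f t) + a) t)
    (hg : HasDerivAt g (-Complex.I • H.at_time t (g t) + b) t) :
    HasDerivAt (fun s => ⟪f s, g s⟫_ℂ) (⟪f t, b⟫_ℂ + ⟪a, g t⟫_ℂ) t := by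
  refine (hf.inner ℂ hg).congr_deriv ?_
  simp only [inner_add_left, inner_add_right, inner_smul_left, inner_smul_right,
    inner_at_time_left, map_neg, Complex.conj_I]
  ring

theorem inner_solutions_eq (H : PeriodicHamiltonian E M) {f g : ℝ → E}
    (hf : ∀ t, HasDerivAt f (-Complex.I • H.at_time t (f t)) t)
    (hg : ∀ t, HasDerivAt g (-Complex.I • H.at_time t (g t)) t) (t : ℝ) :
    ⟪f t, g t⟫_ℂ = ⟪f 0, g 0⟫_ℂ := by
  have h (s : ℝ) : HasDerivAt (fun s => ⟪f s, g s⟫_ℂ) 0 s := by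
    simpa using H.hasDerivAt_inner_solutions (a := 0) (b := 0) (by simpa using hf s)
      (by simpa using hg s)
  exact is_const_of_deriv_eq_zero (fun s => (h s).differentiableAt) (fun s => (h s).deriv) t 0

theorem norm_solution_eq (H : PeriodicHamiltonian E M) {f : ℝ → E}
    (hf : ∀ t, HasDerivAt f (-Complex.I • H.at_time t (f t)) t) (t : ℝ) : ‖f t‖ = ‖f 0‖ := by
  rw [← sq_eq_sq₀ (norm_nonneg _) (norm_nonneg _)]
  have h := H.inner_solutions_eq hf hf t
  rw [inner_self_eq_norm_sq_to_K, inner_self_eq_norm_sq_to_K] at h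
  exact_mod_cast h

/-- The difference of two solutions is a solution, so its norm is conserved and stays 0. -/
theorem solution_unique (H : PeriodicHamiltonian E M) {f g : ℝ → E}
    (hf : ∀ t, HasDerivAt f (-Complex.I • H.at_time t (f t)) t)
    (hg : ∀ t, HasDerivAt g (-Complex.I • H.at_time t (g t)) t) (h0 : f 0 = g 0) : f = g := by
  funext t
  have h := H.norm_solution_eq (f := fun s => f s - g s)
    (fun s => ((hf s).sub (hg s)).congr_deriv (by simp [smul_sub])) t
  simpa [h0, sub_eq_zero] using h

/-- `U` is the propagator of `H` from time `0`. -/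
structure IsPropagator (H : PeriodicHamiltonian E M) (U : ℝ → E →L[ℂ] E) : Prop where
  apply_zero : ∀ v, U 0 v = v
  hasDerivAt : ∀ v t, HasDerivAt (fun s => U s v) (-Complex.I • H.at_time t (U t v)) t

theorem exists_isPropagator [CompleteSpace E] (H : PeriodicHamiltonian E M) :
    ∃ U : ℝ → E →L[ℂ] E, H.IsPropagator U := by
  have hc : Continuous fun t => -Complex.I • H.at_time t := by
    have := H.continuous_at_time
    fun_prop
  obtain ⟨U, h0, hU⟩ := exists_hasDerivAt_mul (A := fun t => -Complex.I • H.at_time t)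
    hc
    (B := ∑ m ∈ Finset.Icc (-(M : ℤ)) (M : ℤ), ‖H.comp m‖)
    (fun t => by rw [norm_smul]; simpa using H.norm_at_time_le t)
  refine ⟨U, fun v => by simp [h0], fun v t => ?_⟩
  have h := ((ContinuousLinearMap.apply ℂ E v).restrictScalars ℝ).hasFDerivAt.comp_hasDerivAt t
    (hU t)
  exact h.congr_deriv (by simp)

namespace IsPropagator

variable {H : PeriodicHamiltonian E M} {U : ℝ → E →L[ℂ] E}

theorem inner_map_map (hU : H.IsPropagator U) (t : ℝ) (v w : E) : ⟪U t v, U t w⟫_ℂ = ⟪v, w⟫_ℂ := by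
  have h := H.inner_solutions_eq (hU.hasDerivAt v) (hU.hasDerivAt w) t
  rwa [hU.apply_zero, hU.apply_zero] at h

theorem norm_map (hU : H.IsPropagator U) (t : ℝ) (v : E) : ‖U t v‖ = ‖v‖ := by
  have h := H.norm_solution_eq (hU.hasDerivAt v) t
  rwa [hU.apply_zero] at h

theorem surjective [FiniteDimensional ℂ E] (hU : H.IsPropagator U) (t : ℝ) :
    Function.Surjective (U t) := by
  have h : Function.Injective (U t : E →ₗ[ℂ] E) := by
    rw [injective_iff_map_eq_zero]
    intro v hv
    rw [← norm_eq_zero, ← hU.norm_map t]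
    exact norm_eq_zero.2 hv
  exact LinearMap.surjective_of_injective h

theorem isStarNormal [FiniteDimensional ℂ E] [CompleteSpace E] (hU : H.IsPropagator U) (t : ℝ) :
    IsStarNormal (U t) := by
  have h1 : star (U t) * U t = 1 := by
    ext v
    refine ext_inner_left ℂ fun w => ?_
    rw [ContinuousLinearMap.star_eq_adjoint, mul_apply_eq_comp,
      ContinuousLinearMap.adjoint_inner_right, hU.inner_map_map, one_apply_eq_self]
  have h2 : U t * star (U t) = 1 := by
    ext v
    obtain ⟨w, rfl⟩ := hU.surjective t v
    have := congrArg (fun A : E →L[ℂ] E => U t (A w)) h1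
    simpa [mul_apply_eq_comp] using this
  exact ⟨h1.trans h2.symm⟩

/-- Driving terms bounded by `ρ` move a solution away from the free evolution at rate at most
`ρ`. -/
theorem norm_sub_le [FiniteDimensional ℂ E] (hU : H.IsPropagator U) {ψ g : ℝ → E} {ρ : ℝ}
    (hψ : ∀ t, HasDerivAt ψ (-Complex.I • H.at_time t (ψ t) + g t) t) (hg : ∀ t, ‖g t‖ ≤ ρ)
    {t : ℝ} (ht : 0 ≤ t) : ‖ψ t - U t (ψ 0)‖ ≤ ρ * t := by
  -- Testing against the free solution ending at the error vector removes the Hamiltonian: ⟪U s y, ψ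
  -- s⟫ has derivative ⟪U s y, g s⟫, and its increment over [0, t] is the squared norm of the error.
  obtain ⟨y, hy⟩ := hU.surjective t (ψ t - U t (ψ 0))
  have hd (s : ℝ) : HasDerivAt (fun s => ⟪U s y, ψ s⟫_ℂ) ⟪U s y, g s⟫_ℂ s := by
    simpa using H.hasDerivAt_inner_solutions (a := 0) (by simpa using hU.hasDerivAt y s) (hψ s)
  have hb (s : ℝ) : ‖⟪U s y, g s⟫_ℂ‖ ≤ ‖y‖ * ρ := by
    refine (norm_inner_le_norm _ _).trans ?_
    rw [hU.norm_map]
    exact mul_le_mul_of_nonneg_left (hg s) (norm_nonneg _)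
  have h := Convex.norm_image_sub_le_of_norm_hasDerivWithin_le
    (fun s _ => (hd s).hasDerivWithinAt) (fun s _ => hb s) convex_univ (Set.mem_univ 0)
    (Set.mem_univ t)
  rw [hU.apply_zero, ← hU.inner_map_map t y (ψ 0), ← inner_sub_right, hy,
    ← hU.norm_map t y, hy, inner_self_eq_norm_sq_to_K, sub_zero, Real.norm_of_nonneg ht] at h
  set z := ψ t - U t (ψ 0)
  have h' : ‖z‖ * ‖z‖ ≤ ‖z‖ * (ρ * t) := by
    have h2 : ‖((‖z‖ : ℂ)) ^ 2‖ = ‖z‖ * ‖z‖ := by simp [sq]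
    have h3 := h2.symm.trans_le h
    linarith
  have hρ : 0 ≤ ρ := (norm_nonneg _).trans (hg 0)
  rcases (norm_nonneg z).eq_or_lt with h0 | h0
  · rw [← h0]; positivity
  · exact le_of_mul_le_mul_left h' h0

/-- By uniqueness, an eigenvector of the one-period propagator evolves into a Floquet solution. -/
theorem isQuasienergy (hU : H.IsPropagator U) {e : ℝ} {w : E} (hw : w ≠ 0)
    (h : U H.period w = Complex.exp (-Complex.I * e * H.period) • w) : H.IsQuasienergy e := by
  have hcancel (t : ℝ) : Complex.exp (-Complex.I * e * t) • Complex.exp (Complex.I * e * t) • U t w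
      = U t w := by
    rw [smul_smul, ← Complex.exp_add]
    simp
  have hper : (fun t => U (t + H.period) w)
      = fun t => Complex.exp (-Complex.I * e * H.period) • U t w := by
    refine H.solution_unique (fun t => ?_) (fun t => ?_) (by simp [h, hU.apply_zero])
    · rw [← H.at_time_add_period]
      exact (hU.hasDerivAt w (t + H.period)).comp_add_const t H.period
    · refine ((hU.hasDerivAt w t).const_smul _).congr_deriv ?_
      rw [map_smul, smul_comm]
  refine ⟨fun t => Complex.exp (Complex.I * e * t) • U t w, fun t => ?_, fun h0 => hw ?_,
    fun t => ?_⟩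
  · have := congrFun hper t
    simp only at this ⊢
    rw [this, smul_smul, ← Complex.exp_add]
    congr 2
    push_cast
    ring
  · have := congrFun h0 0
    simpa [hU.apply_zero] using this
  · simp only [hcancel]
    exact hU.hasDerivAt w t

end IsPropagator

/-- The phase e^{inωt} can be absorbed into the periodic factor. This moves quasienergies between
Brillouin zones. -/
theorem IsQuasienergy.add_int_mul_freq {H : PeriodicHamiltonian E M} {e : ℝ}
    (h : H.IsQuasienergy e) (n : ℤ) : H.IsQuasienergy (e + n * H.freq) := by
  obtain ⟨φ, hper, h0, hd⟩ := h
  have hcancel (t : ℝ) : Complex.exp (-Complex.I * ((e + n * H.freq : ℝ) : ℂ) * t) •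
      Complex.exp (Complex.I * n * H.freq * t) • φ t = Complex.exp (-Complex.I * e * t) • φ t := by
    rw [smul_smul, ← Complex.exp_add]
    congr 2
    push_cast
    ring
  refine ⟨fun t => Complex.exp (Complex.I * n * H.freq * t) • φ t, fun t => ?_, fun hz => h0 ?_,
    fun t => ?_⟩
  · simp only [hper t]
    congr 1
    rw [Complex.ofReal_add, mul_add, Complex.exp_add, H.exp_int_mul_freq_mul_period, mul_one]
  · funext t
    simpa [Complex.exp_ne_zero] using congrFun hz t
  · simp only [hcancel]
    exact hd t

/-- A Floquet-periodic approximate solution of the Schrödinger equation lies close to a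
quasienergy. -/
theorem exists_isQuasienergy_near [FiniteDimensional ℂ E] (H : PeriodicHamiltonian E M)
    {ψ g : ℝ → E} {ρ η e : ℝ}
    (hψ : ∀ t, HasDerivAt ψ (-Complex.I • H.at_time t (ψ t) + g t) t) (hg : ∀ t, ‖g t‖ ≤ ρ)
    (hper : ψ H.period = Complex.exp (-Complex.I * e * H.period) • ψ 0) (h0 : ψ 0 ≠ 0)
    (hη : ρ * H.period ≤ η * ‖ψ 0‖) :
    ∃ e', H.IsQuasienergy e' ∧ |e' - e| * H.period ≤ Real.pi / 2 * η := by
  have : CompleteSpace E := FiniteDimensional.complete ℂ E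
  obtain ⟨U, hU⟩ := H.exists_isPropagator
  have := hU.isStarNormal H.period
  set μ := Complex.exp (-Complex.I * e * H.period) with hμ
  obtain ⟨z, hz, w, hw, hzw⟩ := exists_eigenvector_near_of_isStarNormal (U H.period) (μ := μ) h0
    (η := η) (by
      rw [← hper, norm_sub_rev]
      exact (hU.norm_sub_le hψ hg H.period_pos.le).trans hη)
  have hμ1 : ‖μ‖ = 1 := by
    simpa [hμ] using norm_exp_neg_I_mul e H.period 1
  have hz1 : ‖z‖ = 1 := by
    have := hU.norm_map H.period w
    rw [hzw, norm_smul] at this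
    exact (mul_eq_right₀ (norm_ne_zero_iff.2 hw)).1 this
  have hz0 : z ≠ 0 := norm_ne_zero_iff.1 (by simp [hz1])
  have hμ0 : μ ≠ 0 := Complex.exp_ne_zero _
  -- Both numbers lie on the unit circle, where an arc is at most π/2 times its chord; the arc is T
  -- times the quasienergy shift.
  have hang := Complex.angle_le_mul_norm_sub hz1 hμ1
  rw [Complex.angle_eq_abs_arg hz0 hμ0] at hang
  have hT := H.period_pos
  refine ⟨e - (z / μ).arg / H.period, hU.isQuasienergy hw ?_, ?_⟩
  · rw [hzw]
    congr 1
    have h1 := Complex.norm_mul_exp_arg_mul_I (z / μ)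
    rw [norm_div, hz1, hμ1, div_one, Complex.ofReal_one, one_mul, eq_div_iff hμ0] at h1
    generalize (z / μ).arg = ξ at h1
    rw [← h1, hμ, ← Complex.exp_add]
    congr 1
    have : (H.period : ℂ) ≠ 0 := by exact_mod_cast hT.ne'
    push_cast
    field_simp
    ring
  · rw [sub_sub_cancel_left, abs_neg, abs_div, abs_of_pos hT, div_mul_cancel₀ _ hT.ne']
    exact hang.trans (by gcongr)

end Dynamics

end PeriodicHamiltonian

/-! ### Exponential localization of truncated modes -/

/-- A family indexed by `ℤ` which shrinks by a factor `exp 1` relative to its neighbourhoods of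
radius `P`, away from `l`, decays exponentially. -/
theorem le_exp_of_forall_exp_one_mul_le {f : ℤ → ℝ} (hf : ∀ k, f k ≤ 1) {l : ℤ} {P N : ℝ}
    (hP : 0 < P)
    (step : ∀ (k : ℤ) (β : ℝ), N ≤ |((k - l : ℤ) : ℝ)| →
      (∀ j : ℤ, |((j - k : ℤ) : ℝ)| ≤ P → f j ≤ β) → Real.exp 1 * f k ≤ β) (k : ℤ) :
    f k ≤ Real.exp (1 - (|((k - l : ℤ) : ℝ)| - N) / P) := by
  have main (n : ℕ) : ∀ k : ℤ, N + n * P ≤ |((k - l : ℤ) : ℝ)| → f k ≤ Real.exp (-n) := by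
    induction n with
    | zero => intro k _; simpa using hf k
    | succ n ih =>
      intro k hk
      push_cast at hk
      have h := step k (Real.exp (-n)) (by push_cast; nlinarith) fun j hj => ih j (by
        have := abs_sub_le (k : ℝ) j l
        rw [abs_sub_comm (k : ℝ) j] at this
        push_cast at hj ⊢
        linarith)
      rw [← mul_le_mul_iff_right₀ (Real.exp_pos 1), ← Real.exp_add]
      refine h.trans (Real.exp_le_exp.2 ?_)
      push_cast
      linarith
  -- The number of layers of width `P` is the floor of `s`; rounding down costs the 1 in the
  -- exponent.
  set s := (|((k - l : ℤ) : ℝ)| - N) / P with hs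
  rcases lt_or_ge s 0 with h0 | h0
  · exact (hf k).trans (Real.one_le_exp (by linarith))
  · refine (main ⌊s⌋₊ k ?_).trans (Real.exp_le_exp.2 (by linarith [Nat.lt_floor_add_one s]))
    have := mul_le_mul_of_nonneg_right (Nat.floor_le h0) hP.le
    rw [hs, div_mul_cancel₀ _ hP.ne'] at this
    linarith

namespace PeriodicHamiltonian

section Truncation

variable {E : Type*} [NormedAddCommGroup E] [InnerProductSpace ℂ E] {M : ℕ}

/-- Eigenvectors of the truncated Floquet Hamiltonian, extended by zero to all Fourier indices
and normalized in the supremum norm. -/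
structure IsTruncatedMode (H : PeriodicHamiltonian E M) (L : ℕ) (e : ℝ) (f : ℤ → E) : Prop where
  eq_zero : ∀ k ∉ cutoffIndices L, f k = 0
  smul_eq : ∀ k ∈ cutoffIndices L,
    (e + k * H.freq : ℂ) • f k = ∑ j ∈ cutoffIndices L, H.comp (k - j) (f j)
  norm_le_one : ∀ k, ‖f k‖ ≤ 1
  exists_norm_eq_one : ∃ k, ‖f k‖ = 1

theorem exists_isTruncatedMode (H : PeriodicHamiltonian E M) {L : ℕ} {e : ℝ}
    (h : (H.truncFloquet L).HasEigenvalue (e : ℂ)) : ∃ f, H.IsTruncatedMode L e f := by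
  obtain ⟨Ψ, hΨ⟩ := h.exists_hasEigenvector
  have hne : (Finset.univ : Finset (cutoffIndices L)).Nonempty := by
    by_contra hcon
    rw [Finset.not_nonempty_iff_eq_empty, Finset.univ_eq_empty_iff] at hcon
    exact hΨ.2 (by ext k; exact (hcon.false k).elim)
  obtain ⟨k₀, -, hk₀⟩ := Finset.exists_max_image _ (fun k => ‖Ψ k‖) hne
  set r := ‖Ψ k₀‖ with hr
  have hr0 : 0 < r := by
    refine lt_of_le_of_ne (norm_nonneg _) fun h0 => hΨ.2 ?_
    ext k
    have := hk₀ k (Finset.mem_univ k)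
    rw [← h0] at this
    simpa using this
  have hval (k : cutoffIndices L) :
      (e + ((k : ℤ) : ℂ) * H.freq : ℂ) • Ψ k = ∑ j : cutoffIndices L, H.comp (k - j) (Ψ j) := by
    have := congrArg (fun Φ : TruncSambe E L => Φ k) hΨ.apply_eq_smul
    simp only [truncFloquet, LinearMap.coe_mk, AddHom.coe_mk, PiLp.smul_apply] at this
    rw [add_smul, ← this, sub_add_cancel]
  refine ⟨fun k => if hk : k ∈ cutoffIndices L then (r⁻¹ : ℂ) • Ψ ⟨k, hk⟩ else 0,
    fun k hk => dif_neg hk, fun k hk => ?_, fun k => ?_, k₀, ?_⟩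
  · rw [dif_pos hk, smul_comm, hval ⟨k, hk⟩, Finset.smul_sum,
      ← Finset.sum_coe_sort (cutoffIndices L)]
    refine Finset.sum_congr rfl fun j _ => ?_
    rw [dif_pos j.2, map_smul]
  · split_ifs with hk
    · rw [norm_smul, norm_inv, Complex.norm_real, Real.norm_of_nonneg hr0.le,
        inv_mul_le_one₀ hr0]
      exact hk₀ ⟨k, hk⟩ (Finset.mem_univ _)
    · simp
  · rw [dif_pos k₀.2, norm_smul, norm_inv, Complex.norm_real, Real.norm_of_nonneg hr0.le]
    exact inv_mul_cancel₀ hr0.ne'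

/-- Only indices within `M` of `k` contribute, and there are at most 2M+1 of them. -/
theorem norm_sum_comp_apply_le (H : PeriodicHamiltonian E M) {α : ℝ}
    (hα : ∀ m, ‖H.comp m‖ ≤ α) (S : Finset ℤ) {f : ℤ → E} {k : ℤ} {β : ℝ} (hβ : 0 ≤ β)
    (hf : ∀ j, |j - k| ≤ (M : ℤ) → ‖f j‖ ≤ β) :
    ‖∑ j ∈ S, H.comp (k - j) (f j)‖ ≤ (2 * M + 1) * α * β := by
  have hα0 : 0 ≤ α := (norm_nonneg _).trans (hα 0)
  calc ‖∑ j ∈ S, H.comp (k - j) (f j)‖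
      = ‖∑ j ∈ S.filter (fun j => |j - k| ≤ (M : ℤ)), H.comp (k - j) (f j)‖ := by
        rw [Finset.sum_filter_of_ne]
        intro j _ hj
        by_contra hcon
        rw [abs_sub_comm, not_le] at hcon
        exact hj (by rw [H.comp_eq_zero _ hcon]; simp)
    _ ≤ ∑ j ∈ S.filter (fun j => |j - k| ≤ (M : ℤ)), α * β := by
        refine norm_sum_le_of_le _ fun j hj => ?_
        exact (ContinuousLinearMap.le_opNorm _ _).trans
          (mul_le_mul (hα _) (hf j (Finset.mem_filter.1 hj).2) (norm_nonneg _) hα0)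
    _ ≤ ∑ j ∈ Finset.Icc (k - M) (k + M), α * β := by
        refine Finset.sum_le_sum_of_subset_of_nonneg (fun j hj => ?_)
          fun _ _ _ => mul_nonneg hα0 hβ
        have := abs_le.1 (Finset.mem_filter.1 hj).2
        rw [Finset.mem_Icc]
        omega
    _ = (2 * M + 1) * α * β := by
        rw [Finset.sum_const, Int.card_Icc, nsmul_eq_mul,
          show k + M + 1 - (k - M) = ((2 * M + 1 : ℕ) : ℤ) by push_cast; ring, Int.toNat_natCast]
        push_cast
        ring

/-- Truncated modes with quasienergy in the Brillouin zone `l` are localized near `l`. -/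
theorem IsTruncatedMode.norm_le_exp {H : PeriodicHamiltonian E M} {L : ℕ} {e : ℝ} {f : ℤ → E}
    (hf : H.IsTruncatedMode L e f) {α : ℝ} (hα : ∀ m, ‖H.comp m‖ ≤ α) {l : ℤ}
    (he : e ∈ H.brillouinZone l) (k : ℤ) :
    ‖f k‖ ≤ Real.exp (1 - (|((k - l : ℤ) : ℝ)| - (1 + (2 * M + 1) * (α * H.period))) / (M + 1)) := by
  have hα0 : 0 ≤ α := (norm_nonneg _).trans (hα 0)
  refine le_exp_of_forall_exp_one_mul_le (f := fun k => ‖f k‖) hf.norm_le_one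
    (by positivity) (fun k β hk hβ => ?_) k
  have hβ0 : 0 ≤ β := (norm_nonneg _).trans (hβ k (by simp; positivity))
  by_cases hkL : k ∈ cutoffIndices L
  swap
  · simpa [hf.eq_zero k hkL] using hβ0
  have h1 : ‖(e + k * H.freq : ℂ) • f k‖ ≤ (2 * M + 1) * α * β := by
    rw [hf.smul_eq k hkL]
    refine H.norm_sum_comp_apply_le hα _ hβ0 fun j hj => hβ j ?_
    have : |((j - k : ℤ) : ℝ)| ≤ M := by exact_mod_cast hj
    linarith
  rw [norm_smul, show (e + k * H.freq : ℂ) = ((e + k * H.freq : ℝ) : ℂ) by push_cast; rfl,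
    Complex.norm_real, Real.norm_eq_abs] at h1
  have hω := H.freq_pos
  have h2 : (|((k - l : ℤ) : ℝ)| - 1 / 2) * H.freq ≤ |e + k * H.freq| := by
    obtain ⟨ha, hb⟩ := he
    push_cast
    rcases abs_cases ((k : ℝ) - l) with ⟨h, _⟩ | ⟨h, _⟩ <;> rw [h]
    · refine le_trans ?_ (le_abs_self _)
      nlinarith
    · refine le_trans ?_ (neg_le_abs _)
      nlinarith
  -- The bound e ≤ 2π = ωT is what makes a distance (2M+1)αT suffice for a contraction by e.
  have hpi : Real.exp 1 ≤ H.freq * H.period := by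
    rw [H.freq_mul_period]
    linarith [Real.exp_one_lt_d9, Real.pi_gt_three]
  set Q := (2 * M + 1) * α with hQ
  have hQ0 : 0 ≤ Q := by positivity
  have h3 : H.freq / 2 + Real.exp 1 * Q ≤ |e + k * H.freq| := by
    refine le_trans ?_ h2
    have h4 : (1 + (2 * M + 1) * (α * H.period) - 1 / 2) * H.freq
        ≤ (|((k - l : ℤ) : ℝ)| - 1 / 2) * H.freq := by gcongr
    refine le_trans ?_ h4
    have h5 := mul_le_mul_of_nonneg_right hpi hQ0
    rw [hQ] at *
    linarith
  have h6 := (mul_le_mul_of_nonneg_right h3 (norm_nonneg (f k))).trans h1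
  have h7 := norm_nonneg (f k)
  -- If `Q` = 0 there is no coupling to divide by; the spare ω/2 in `h3` then forces `f k` = 0.
  rcases hQ0.eq_or_lt with h0 | h0
  · rw [← h0] at h6
    have : ‖f k‖ = 0 := by nlinarith
    rw [this, mul_zero]
    exact hβ0
  · refine le_of_mul_le_mul_left ?_ h0
    nlinarith

/-! ### The trial solution and its leakage -/

/-- The trial solution assembled from Fourier components `f`. -/
noncomputable def trialSolution (H : PeriodicHamiltonian E M) (L : ℕ) (e : ℝ) (f : ℤ → E) (t : ℝ) :
    E :=
  ∑ k ∈ cutoffIndices L, Complex.exp (-Complex.I * (e + k * H.freq) * t) • f k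

theorem norm_exp_neg_I_mul_add (a b c : ℝ) (k : ℤ) :
    ‖Complex.exp (-Complex.I * (a + k * b) * c)‖ = 1 := by
  have := norm_exp_neg_I_mul (a + k * b) c 1
  push_cast at this
  simpa using this

/-- The part of `i H ψ` that the truncation drops, for the trial solution `ψ`. -/
noncomputable def leakage (H : PeriodicHamiltonian E M) (L : ℕ) (e : ℝ) (f : ℤ → E) (t : ℝ) : E :=
  Complex.I • ∑ j ∈ cutoffIndices L,
    ∑ m ∈ (Finset.Icc (-(M : ℤ)) (M : ℤ)).filter (fun m => j + m ∉ cutoffIndices L),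
      Complex.exp (-Complex.I * (e + (j + m : ℤ) * H.freq) * t) • H.comp m (f j)

theorem trialSolution_period (H : PeriodicHamiltonian E M) (L : ℕ) (e : ℝ) (f : ℤ → E) :
    H.trialSolution L e f H.period
      = Complex.exp (-Complex.I * e * H.period) • H.trialSolution L e f 0 := by
  simp only [trialSolution, Finset.smul_sum]
  refine Finset.sum_congr rfl fun k _ => ?_
  have h := H.exp_int_mul_freq_mul_period (-k)
  push_cast at h
  rw [Complex.ofReal_zero, mul_zero, Complex.exp_zero, one_smul,
    show -Complex.I * (e + k * H.freq) * H.period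
      = -Complex.I * e * H.period + Complex.I * -k * H.freq * H.period by ring, Complex.exp_add, h,
    mul_one]

/-- H_m sends harmonic j to j+m. The targets inside [L] reproduce the truncated operator, the others
form the leakage. -/
theorem at_time_trialSolution (H : PeriodicHamiltonian E M) (L : ℕ) (e : ℝ) (f : ℤ → E) (t : ℝ) :
    Complex.I • H.at_time t (H.trialSolution L e f t) =
      Complex.I • (∑ k ∈ cutoffIndices L, Complex.exp (-Complex.I * (e + k * H.freq) * t) •
        ∑ j ∈ cutoffIndices L, H.comp (k - j) (f j)) + H.leakage L e f t := by
  rw [leakage, ← smul_add]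
  congr 1
  have h1 : H.at_time t (H.trialSolution L e f t) = ∑ j ∈ cutoffIndices L,
      ∑ m ∈ Finset.Icc (-(M : ℤ)) (M : ℤ),
        Complex.exp (-Complex.I * (e + (j + m : ℤ) * H.freq) * t) • H.comp m (f j) := by
    simp only [at_time, trialSolution, map_sum, sum_apply, smul_apply, map_smul]
    refine Finset.sum_congr rfl fun j _ => ?_
    rw [Finset.smul_sum]
    refine Finset.sum_congr rfl fun m _ => ?_
    rw [smul_smul, ← Complex.exp_add]
    congr 2
    push_cast
    ring
  simp only [Finset.smul_sum]
  rw [h1, Finset.sum_comm (s := cutoffIndices L) (t := cutoffIndices L), ← Finset.sum_add_distrib]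
  refine Finset.sum_congr rfl fun j _ => ?_
  rw [← Finset.sum_filter_add_sum_filter_not _ (fun m => j + m ∈ cutoffIndices L)]
  congr 1
  rw [← Finset.sum_filter_of_ne (s := cutoffIndices L) (p := fun k => |k - j| ≤ (M : ℤ))]
  · refine Finset.sum_nbij' (fun m => j + m) (fun k => k - j) ?_ ?_ ?_ ?_ ?_
    · intro m hm
      rw [Finset.mem_filter] at *
      rw [Finset.mem_Icc] at hm
      exact ⟨hm.2, by rw [add_sub_cancel_left]; exact abs_le.2 hm.1⟩
    · intro k hk
      rw [Finset.mem_filter] at *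
      exact ⟨Finset.mem_Icc.2 (abs_le.1 hk.2), by rw [add_sub_cancel]; exact hk.1⟩
    · intro m _; exact add_sub_cancel_left j m
    · intro k _; exact add_sub_cancel j k
    · intro m _; rw [add_sub_cancel_left]
  · intro k _ hk
    by_contra hcon
    exact hk (by rw [H.comp_eq_zero _ (not_le.1 hcon)]; simp)

/-- The eigenvalue equation cancels all harmonics kept by the truncation, leaving the leakage as the
only source. -/
theorem IsTruncatedMode.hasDerivAt_trialSolution {H : PeriodicHamiltonian E M} {L : ℕ} {e : ℝ}
    {f : ℤ → E} (hf : H.IsTruncatedMode L e f) (t : ℝ) :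
    HasDerivAt (H.trialSolution L e f)
      (-Complex.I • H.at_time t (H.trialSolution L e f t) + H.leakage L e f t) t := by
  have h (k : ℤ) : HasDerivAt
      (fun s : ℝ => Complex.exp (-Complex.I * (e + k * H.freq) * s) • f k)
      (-Complex.I • Complex.exp (-Complex.I * (e + k * H.freq) * t) •
        (e + k * H.freq : ℂ) • f k) t := by
    have h1 : HasDerivAt (fun s : ℝ => -Complex.I * (e + k * H.freq) * (s : ℂ))
        (-Complex.I * (e + k * H.freq)) t := by
      simpa using (Complex.ofRealCLM.hasDerivAt (x := t)).const_mul
        (-Complex.I * (e + k * H.freq))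
    refine (h1.cexp.smul_const (f k)).congr_deriv ?_
    rw [smul_smul, smul_smul]
    congr 1
    ring
  refine (HasDerivAt.fun_sum fun k (_ : k ∈ cutoffIndices L) => h k).congr_deriv ?_
  rw [neg_smul, at_time_trialSolution, neg_add, neg_add_cancel_right, ← neg_smul,
    Finset.smul_sum]
  exact Finset.sum_congr rfl fun k hk => by rw [hf.smul_eq k hk]

theorem norm_leakage_le (H : PeriodicHamiltonian E M) {α : ℝ} (hα : ∀ m, ‖H.comp m‖ ≤ α) {L : ℕ}
    {e β : ℝ} {f : ℤ → E} (hβ0 : 0 ≤ β)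
    (hβ : ∀ j ∈ cutoffIndices L, ∀ m : ℤ, |m| ≤ M → j + m ∉ cutoffIndices L → ‖f j‖ ≤ β) (t : ℝ) :
    ‖H.leakage L e f t‖ ≤ 2 * L * ((2 * M + 1) * (α * β)) := by
  have hα0 : 0 ≤ α := (norm_nonneg _).trans (hα 0)
  rw [leakage, norm_smul, Complex.norm_I, one_mul]
  calc _ ≤ ∑ j ∈ cutoffIndices L, (2 * M + 1) * (α * β) := by
        refine norm_sum_le_of_le _ fun j hj => ?_
        calc _ ≤ ∑ m ∈ (Finset.Icc (-(M : ℤ)) (M : ℤ)).filter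
              (fun m => j + m ∉ cutoffIndices L), α * β := by
              refine norm_sum_le_of_le _ fun m hm => ?_
              rw [Finset.mem_filter, Finset.mem_Icc] at hm
              rw [norm_smul, norm_exp_neg_I_mul_add, one_mul]
              exact (ContinuousLinearMap.le_opNorm _ _).trans
                (mul_le_mul (hα _) (hβ j hj m (abs_le.2 hm.1) hm.2) (norm_nonneg _) hα0)
          _ ≤ ∑ m ∈ Finset.Icc (-(M : ℤ)) (M : ℤ), α * β :=
              Finset.sum_le_sum_of_subset_of_nonneg (Finset.filter_subset _ _)
                fun _ _ _ => mul_nonneg hα0 hβ0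
          _ = (2 * M + 1) * (α * β) := by
              rw [Finset.sum_const, Int.card_Icc, nsmul_eq_mul,
                show (M : ℤ) + 1 - -M = ((2 * M + 1 : ℕ) : ℤ) by push_cast; ring,
                Int.toNat_natCast]
              push_cast
              ring
    _ = 2 * L * ((2 * M + 1) * (α * β)) := by
        rw [Finset.sum_const, Int.card_Icc, nsmul_eq_mul,
          show (L : ℤ) + 1 - (-L + 1) = ((2 * L : ℕ) : ℤ) by push_cast; ring, Int.toNat_natCast]
        push_cast
        ring

theorem integral_exp_int_mul_freq (H : PeriodicHamiltonian E M) (n : ℤ) :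
    ∫ t in (0 : ℝ)..H.period, Complex.exp (Complex.I * n * H.freq * t)
      = if n = 0 then (H.period : ℂ) else 0 := by
  split_ifs with hn
  · simp [hn]
  · have hω : (H.freq : ℂ) ≠ 0 := by exact_mod_cast H.freq_pos.ne'
    have hn' : (n : ℂ) ≠ 0 := by exact_mod_cast hn
    rw [integral_exp_mul_complex (by simp [hω, hn', Complex.I_ne_zero]),
      H.exp_int_mul_freq_mul_period]
    simp

/-- Each Fourier component is bounded by the supremum of the trial solution over a period. -/
theorem norm_le_of_norm_trialSolution_le [CompleteSpace E] (H : PeriodicHamiltonian E M) {L : ℕ}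
    {e s : ℝ} {f : ℤ → E}
    (hs : ∀ t, 0 ≤ t → t ≤ H.period → ‖H.trialSolution L e f t‖ ≤ s) {k : ℤ}
    (hk : k ∈ cutoffIndices L) : ‖f k‖ ≤ s := by
  have hT := H.period_pos
  -- Orthogonality of the harmonics over a period isolates `f k`.
  have hint : ∫ t in (0 : ℝ)..H.period,
      Complex.exp (-Complex.I * ((-e : ℝ) + (-k : ℤ) * H.freq) * t) • H.trialSolution L e f t
        = (H.period : ℂ) • f k := by
    have h1 (t : ℝ) : Complex.exp (-Complex.I * ((-e : ℝ) + (-k : ℤ) * H.freq) * t) •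
        H.trialSolution L e f t = ∑ j ∈ cutoffIndices L,
          Complex.exp (Complex.I * (k - j : ℤ) * H.freq * t) • f j := by
      simp only [trialSolution, Finset.smul_sum, smul_smul, ← Complex.exp_add]
      refine Finset.sum_congr rfl fun j _ => ?_
      congr 2
      push_cast
      ring
    simp only [h1]
    rw [intervalIntegral.integral_finsetSum
      fun j _ => Continuous.intervalIntegrable (by fun_prop) _ _]
    simp only [intervalIntegral.integral_smul_const, integral_exp_int_mul_freq]
    rw [Finset.sum_eq_single k (fun j _ hj => by simp [sub_eq_zero, hj.symm])
      (fun h => absurd hk h)]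
    simp
  have h2 := intervalIntegral.norm_integral_le_of_norm_le_const (a := 0) (b := H.period) (C := s)
    (f := fun t : ℝ => Complex.exp (-Complex.I * ((-e : ℝ) + (-k : ℤ) * H.freq) * t) •
      H.trialSolution L e f t) fun t ht => by
        rw [Set.uIoc_of_le hT.le] at ht
        rw [norm_smul, norm_exp_neg_I_mul_add, one_mul]
        exact hs t ht.1.le ht.2
  rw [hint, norm_smul, Complex.norm_real, Real.norm_of_nonneg hT.le, sub_zero, abs_of_pos hT,
    mul_comm] at h2
  exact le_of_mul_le_mul_right h2 hT

/-- A truncated mode with little leakage has its quasienergy close to an exact one. -/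
theorem IsTruncatedMode.exists_isQuasienergy_near [FiniteDimensional ℂ E]
    {H : PeriodicHamiltonian E M} {L : ℕ} {e ρ : ℝ} {f : ℤ → E} (hf : H.IsTruncatedMode L e f)
    (hρ : ∀ t, ‖H.leakage L e f t‖ ≤ ρ) (hsmall : ρ * H.period ≤ 1 / 2) :
    ∃ e', H.IsQuasienergy e' ∧ |e' - e| ≤ H.freq * (ρ * H.period) / 2 := by
  have : CompleteSpace E := FiniteDimensional.complete ℂ E
  have hT := H.period_pos
  have hρ0 : 0 ≤ ρ := (norm_nonneg _).trans (hρ 0)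
  obtain ⟨k, hk⟩ := hf.exists_norm_eq_one
  have hkL : k ∈ cutoffIndices L := by
    by_contra hcon
    rw [hf.eq_zero k hcon, norm_zero] at hk
    exact zero_ne_one hk
  -- A component of norm 1 forces the supremum of ‖ψ‖ over a period to be at least 1, and ‖ψ(t)‖
  -- exceeds ‖ψ(0)‖ by at most ρT ≤ 1/2.
  have h0 : 1 / 2 ≤ ‖H.trialSolution L e f 0‖ := by
    obtain ⟨U, hU⟩ := H.exists_isPropagator
    have h := H.norm_le_of_norm_trialSolution_le (e := e) (f := f)
      (s := ρ * H.period + ‖H.trialSolution L e f 0‖) (fun t h0 hT' => ?_) hkL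
    · linarith
    · have h1 := hU.norm_sub_le hf.hasDerivAt_trialSolution hρ h0
      have h2 := norm_le_norm_sub_add (H.trialSolution L e f t) (U t (H.trialSolution L e f 0))
      rw [hU.norm_map] at h2
      have h3 := mul_le_mul_of_nonneg_left hT' hρ0
      linarith
  obtain ⟨e', he', hle⟩ := H.exists_isQuasienergy_near (η := 2 * (ρ * H.period))
    hf.hasDerivAt_trialSolution hρ (H.trialSolution_period L e f)
    (norm_pos_iff.1 (by linarith)) (by nlinarith [mul_nonneg hρ0 hT.le])
  refine ⟨e', he', le_of_mul_le_mul_right (hle.trans_eq ?_) hT⟩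
  linear_combination -(ρ * H.period / 2) * H.freq_mul_period

end Truncation

end PeriodicHamiltonian

/-! ### Transfer of the rounding promise and choice of the cutoff -/

namespace PeriodicHamiltonian

/-- An eigenvalue close to an exact quasienergy inherits half of the rounding promise. -/
theorem HasRoundingPromise.notMem_roundingIntervals {E : Type*} [NormedAddCommGroup E]
    [InnerProductSpace ℂ E] {M : ℕ} {H : PeriodicHamiltonian E M} {ν : ℝ} {b : ℕ}
    (hH : H.HasRoundingPromise ν b) (hν : ν < 1) (hb : b ≠ 0) {l : ℤ} {e e' : ℝ}
    (he' : H.IsQuasienergy e') (hclose : |e' - e| < H.freq * (ν / (4 * 2 ^ b))) (n : ℤ) :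
    e / ((2 : ℝ) ^ n * H.freq) ∉
      roundingIntervals ((-(l : ℝ) - 1 / 2) * (2 : ℝ) ^ b) ((-(l : ℝ) + 1 / 2) * (2 : ℝ) ^ b)
        (ν / 2) ((b : ℤ) + n) := by
  have hω := H.freq_pos
  obtain ⟨c, rfl⟩ := Nat.exists_eq_succ_of_ne_zero hb
  set p : ℤ := 2 ^ c with hp
  have hp1 : (1 : ℝ) ≤ p := by
    rw [hp]; push_cast; exact one_le_pow₀ one_le_two
  have hq : (2 : ℝ) ^ (c + 1) = 2 * p := by rw [hp, pow_succ]; push_cast; ring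
  have hp' : (2 : ℝ) ^ (((c + 1 : ℕ) : ℤ) - 1) = p := by
    rw [hp]; push_cast; rw [add_sub_cancel_right, zpow_natCast]
  -- The promise with denominators cleared; `p` is half of 2^b, an integer because b ≠ 0.
  have key (e'' : ℝ) (h : H.IsQuasienergy e'') (y : ℤ) (hy : -p ≤ y) (hy' : y ≤ p)
      (hlo : -p * H.freq ≤ 2 * p * e'') (hhi : 2 * p * e'' < p * H.freq)
      (h1 : (y - ν / 2) * H.freq ≤ 2 * p * e'') (h2 : 2 * p * e'' < (y + ν / 2) * H.freq) :
      False := by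
    refine hH e'' h ⟨?_, ?_⟩ ?_
    · push_cast; nlinarith
    · push_cast; nlinarith
    · rw [roundingIntervals]
      simp only [Set.mem_iUnion, Set.mem_ofPred_eq, exists_prop]
      refine ⟨y, ⟨by rw [hp']; exact_mod_cast hy, by rw [hp']; exact_mod_cast hy'⟩, ?_, ?_⟩
      · rw [zpow_natCast, hq, div_le_div_iff₀ (by positivity) hω]
        linarith
      · rw [zpow_natCast, hq, div_lt_div_iff₀ hω (by positivity)]
        linarith
  rw [roundingIntervals]
  simp only [Set.mem_iUnion, Set.mem_ofPred_eq, exists_prop, not_exists, not_and]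
  rintro x ⟨hx1, hx2⟩ ⟨hx3, hx4⟩
  -- The factor 2^n occurs on both sides and cancels, whatever the number of extra bits.
  have h2n : (0 : ℝ) < 2 ^ n := by positivity
  rw [zpow_add₀ two_ne_zero, zpow_natCast, hq, div_le_div_iff₀ (by positivity) (by positivity)]
    at hx3
  rw [zpow_add₀ two_ne_zero, zpow_natCast, hq, div_lt_div_iff₀ (by positivity) (by positivity)]
    at hx4
  have hx3' : (x - ν / 2 / 2) * H.freq ≤ 2 * p * e := by
    refine le_of_mul_le_mul_right ?_ h2n
    linarith
  have hx4' : 2 * p * e < (x + ν / 2 / 2) * H.freq := by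
    refine lt_of_mul_lt_mul_right ?_ h2n.le
    linarith
  rw [hq] at hx1 hx2 hclose
  have hclose' : |2 * p * e' - 2 * p * e| < H.freq * (ν / 4) := by
    rw [← mul_sub, abs_mul, abs_of_pos (by positivity)]
    have := mul_lt_mul_of_pos_left hclose (show (0 : ℝ) < 2 * p by positivity)
    refine this.trans_eq ?_
    field_simp
  obtain ⟨hc1, hc2⟩ := abs_lt.1 hclose'
  have hy : -p ≤ x + l * (2 * p) := by
    have : (-p : ℝ) ≤ x + l * (2 * p) := by linarith
    exact_mod_cast this
  have hy' : x + l * (2 * p) ≤ p := by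
    have : (x + l * (2 * p) : ℝ) ≤ p := by linarith
    exact_mod_cast this
  set y := x + l * (2 * p) with hydef
  have hyR : (y : ℝ) = x + l * (2 * p) := by rw [hydef]; push_cast; ring
  have hlow : (y - ν / 2) * H.freq < 2 * p * (e' + l * H.freq) := by
    rw [hyR]; linarith
  have hupp : 2 * p * (e' + l * H.freq) < (y + ν / 2) * H.freq := by
    rw [hyR]; linarith
  have hνω : ν * H.freq < H.freq := by nlinarith
  have hpω : H.freq ≤ p * H.freq := by nlinarith
  have hyω : (-p : ℝ) * H.freq ≤ y * H.freq :=
    mul_le_mul_of_nonneg_right (by exact_mod_cast hy) hω.le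
  have hyω' : (y : ℝ) * H.freq ≤ p * H.freq :=
    mul_le_mul_of_nonneg_right (by exact_mod_cast hy') hω.le
  -- The shifted quasienergy may leave BZ_0 although the shifted `e` does not. As ν < 1, this
  -- happens only for an extreme centre y = ±p; one more shift by ω wraps it to the opposite
  -- extreme, which the promise also covers.
  rcases lt_or_ge (2 * p * (e' + l * H.freq)) (-p * H.freq) with h1 | h1
  · have hyp : y = -p := by
      refine le_antisymm (Int.le_of_lt_add_one ?_) hy
      have : (y : ℝ) < -p + 1 := by
        refine lt_of_mul_lt_mul_right ?_ hω.le
        linarith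
      exact_mod_cast this
    have hypR : (y : ℝ) = -p := by rw [hyp]; push_cast; rfl
    rw [hypR] at hlow hupp
    have hs : 2 * p * (e' + (l + 1 : ℤ) * H.freq)
        = 2 * p * (e' + l * H.freq) + 2 * (p * H.freq) := by push_cast; ring
    exact key _ (he'.add_int_mul_freq (l + 1)) p (by omega) le_rfl (by rw [hs]; linarith)
      (by rw [hs]; linarith) (by rw [hs]; linarith) (by rw [hs]; linarith)
  rcases lt_or_ge (2 * p * (e' + l * H.freq)) (p * H.freq) with h2 | h2
  · exact key _ (he'.add_int_mul_freq l) y hy hy' h1 h2 hlow.le hupp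
  · have hyp : y = p := by
      refine le_antisymm hy' (Int.le_of_sub_one_lt ?_)
      have : (p : ℝ) - 1 < y := by
        refine lt_of_mul_lt_mul_right ?_ hω.le
        linarith
      exact_mod_cast this
    have hypR : (y : ℝ) = p := by rw [hyp]
    rw [hypR] at hlow hupp
    have hs : 2 * p * (e' + (l - 1 : ℤ) * H.freq)
        = 2 * p * (e' + l * H.freq) - 2 * (p * H.freq) := by push_cast; ring
    exact key _ (he'.add_int_mul_freq (l - 1)) (-p) le_rfl (by omega) (by rw [hs]; linarith)
      (by rw [hs]; linarith) (by rw [hs]; push_cast; linarith) (by rw [hs]; push_cast; linarith)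

/-- The cutoff is large enough for the exponential localization to beat every other factor. -/
theorem mul_exp_lt_one_of_cutoff {P K L X : ℝ} (hP : 1 ≤ P) (hK : 0 < K) (hL : 0 ≤ L)
    (hX : 0 ≤ X) (h : (128 * P ^ 3 * Real.exp (2 + K) + 4 * P * (K + 3)) * X ≤ L) :
    8 * P * L * X * Real.exp (2 + K + (K + 3) * X - L / P) < 1 := by
  have hP0 : 0 < P := by linarith
  set A := Real.exp (2 + K) with hA
  have hA0 : 0 < A := Real.exp_pos _
  rcases hL.eq_or_lt with h0 | h0
  · rw [← h0]; simp
  have hX1 : 128 * P ^ 3 * A * X < L ∨ X = 0 := by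
    rcases hX.eq_or_lt with h1 | h1
    · exact Or.inr h1.symm
    · left
      have : 0 < 4 * P * (K + 3) * X := by positivity
      linarith
  rcases hX1 with hX1 | rfl
  swap
  · simp
  -- The second summand of the constant absorbs (K+3)X into the decay, leaving e^{-L/(2P)}; the
  -- first handles the prefactor, via L² ≤ 16P²e^{L/(2P)}.
  have hX2 : (K + 3) * X ≤ L / (4 * P) := by
    rw [le_div_iff₀ (by positivity)]
    have : 0 ≤ 128 * P ^ 3 * A * X := by positivity
    linarith
  have hsplit : Real.exp (2 + K + (K + 3) * X - L / P)
      ≤ A * Real.exp (-(L / (2 * P))) := by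
    rw [hA, ← Real.exp_add]
    refine Real.exp_le_exp.2 ?_
    have e1 : L / (4 * P) = L / P / 4 := by field_simp
    have e2 : L / (2 * P) = L / P / 2 := by field_simp
    have : 0 ≤ L / P := by positivity
    rw [e1] at hX2
    rw [e2]
    linarith
  have hsq : L ^ 2 ≤ 16 * P ^ 2 * Real.exp (L / (2 * P)) := by
    have h1 := Real.add_one_le_exp (L / (4 * P))
    have h2 : 0 ≤ L / (4 * P) := by positivity
    have h3 : (L / (4 * P)) ^ 2 ≤ Real.exp (L / (2 * P)) := by
      calc (L / (4 * P)) ^ 2 ≤ Real.exp (L / (4 * P)) ^ 2 := by gcongr; linarith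
        _ = Real.exp (L / (2 * P)) := by
          rw [← Real.exp_nat_mul]
          congr 1
          push_cast
          field_simp
          norm_num
    calc L ^ 2 = 16 * P ^ 2 * (L / (4 * P)) ^ 2 := by field_simp; norm_num
      _ ≤ _ := by gcongr
  calc 8 * P * L * X * Real.exp (2 + K + (K + 3) * X - L / P)
      ≤ 8 * P * L * X * (A * Real.exp (-(L / (2 * P)))) := by gcongr
    _ = (128 * P ^ 3 * A * X) * (L * Real.exp (-(L / (2 * P))) / (16 * P ^ 2)) := by
        field_simp
        ring
    _ < L * (L * Real.exp (-(L / (2 * P))) / (16 * P ^ 2)) := by gcongr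
    _ = L ^ 2 * (Real.exp (-(L / (2 * P))) / (16 * P ^ 2)) := by ring
    _ ≤ (16 * P ^ 2 * Real.exp (L / (2 * P))) * (Real.exp (-(L / (2 * P))) / (16 * P ^ 2)) := by
        gcongr
    _ = 1 := by
        rw [Real.exp_neg]
        field_simp

/-- An eigenvalue of the truncated Floquet Hamiltonian in the Brillouin zone `l` is exponentially
close, in the cutoff `L`, to a quasienergy. -/
theorem exists_isQuasienergy_near_eigenvalue {E : Type*} [NormedAddCommGroup E]
    [InnerProductSpace ℂ E] [FiniteDimensional ℂ E] {M : ℕ} (H : PeriodicHamiltonian E M) {α : ℝ}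
    (hα : ∀ m, ‖H.comp m‖ ≤ α) {l : ℤ} {L : ℕ} {e X : ℝ}
    (heig : (H.truncFloquet L).HasEigenvalue (e : ℂ)) (he : e ∈ H.brillouinZone l)
    (hX : α * H.period + |(l : ℝ)| ≤ X)
    (hsmall : 4 * (M + 1) * L * X * Real.exp (2 + 2 * X - L / (M + 1)) ≤ 1 / 2) :
    ∃ e', H.IsQuasienergy e' ∧
      |e' - e| ≤ H.freq * (4 * (M + 1) * L * X * Real.exp (2 + 2 * X - L / (M + 1))) / 2 := by
  have hα0 : 0 ≤ α := (norm_nonneg _).trans (hα 0)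
  have hT := H.period_pos
  have hω := H.freq_pos
  have hαT : 0 ≤ α * H.period := by positivity
  have hl := abs_nonneg (l : ℝ)
  have hX0 : 0 ≤ X := by linarith
  obtain ⟨f, hf⟩ := H.exists_isTruncatedMode heig
  set β := Real.exp (2 + 2 * X - L / (M + 1)) with hβ
  have hβ0 : 0 < β := Real.exp_pos _
  have hbd (j : ℤ) (hj : j ∈ cutoffIndices L) (m : ℤ) (hm : |m| ≤ M)
      (hjm : j + m ∉ cutoffIndices L) : ‖f j‖ ≤ β := by
    refine (hf.norm_le_exp hα he j).trans (Real.exp_le_exp.2 ?_)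
    -- Since [L] starts at -L+1, the lower edge gives exactly L - M; the upper edge has one to
    -- spare.
    have h1 : (L : ℝ) - M ≤ |(j : ℝ)| := by
      have : (L : ℤ) - M ≤ |j| := by
        rw [Finset.mem_Icc] at hj hjm
        rw [abs_le] at hm
        rcases abs_cases j with ⟨h, _⟩ | ⟨h, _⟩ <;> rw [h] <;> omega
      exact_mod_cast this
    have h2 : |(j : ℝ)| - |(l : ℝ)| ≤ |((j - l : ℤ) : ℝ)| := by
      push_cast
      exact abs_sub_abs_le_abs_sub _ _
    have hM : (0 : ℝ) < M + 1 := by positivity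
    have h3 : (L : ℝ) / (M + 1) - 1 - 2 * X
        ≤ (|((j - l : ℤ) : ℝ)| - (1 + (2 * M + 1) * (α * H.period))) / (M + 1) := by
      rw [le_div_iff₀ hM, sub_mul, sub_mul, div_mul_cancel₀ _ hM.ne']
      have hM0 : (0 : ℝ) ≤ M := Nat.cast_nonneg M
      have h4 : (2 * M + 1) * (α * H.period + |(l : ℝ)|) ≤ (2 * M + 1) * X := by gcongr
      have h5 : 0 ≤ (2 * M) * |(l : ℝ)| := by positivity
      linarith
    linarith
  have hρ := H.norm_leakage_le hα (L := L) (e := e) hβ0.le hbd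
  have hle : 2 * L * ((2 * M + 1) * (α * β)) * H.period ≤ 4 * (M + 1) * L * X * β := by
    calc 2 * L * ((2 * M + 1) * (α * β)) * H.period
        = (2 * L * β) * ((2 * M + 1) * (α * H.period)) := by ring
      _ ≤ (2 * L * β) * ((2 * M + 2) * X) := by gcongr <;> linarith
      _ = _ := by ring
  obtain ⟨e', he', h⟩ := hf.exists_isQuasienergy_near hρ (hle.trans hsmall)
  exact ⟨e', he', h.trans (by gcongr)⟩

end PeriodicHamiltonian

/-! ### Assembly of the theorem -/

/-- The constant `C` in `L ≥ C (αT + |l| + log (1/(εν)))` depends only on the number `M` of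
harmonics and on the constant `K` in `b' ≤ K (1 + log (1/ε))`. -/
theorem proposition4 (M : ℕ) (K : ℝ) (hK : 0 < K) :
    ∃ C : ℝ, 0 < C ∧
      ∀ (E : Type*) [NormedAddCommGroup E] [InnerProductSpace ℂ E] [FiniteDimensional ℂ E]
        (H : PeriodicHamiltonian E M) (α ε ν : ℝ) (b' : ℕ) (l : ℤ) (L : ℕ),
        (∀ m : ℤ, ‖H.comp m‖ ≤ α) →
        0 < ε → ε < 1 → 0 < ν → ν < 1 →
        ((2 : ℝ) ^ b')⁻¹ ≤ ε → (b' : ℝ) ≤ K * (1 + Real.log (1 / ε)) →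
        H.HasRoundingPromise ν b' →
        C * (α * H.period + |(l : ℝ)| + Real.log (1 / (ε * ν))) ≤ (L : ℝ) →
        ∀ e : ℝ, (H.truncFloquet L).HasEigenvalue (e : ℂ) → e ∈ H.brillouinZone l →
          e / ((2 : ℝ) ^ H.normBits α L * H.freq) ∉
            roundingIntervals ((-(l : ℝ) - 1 / 2) * (2 : ℝ) ^ b') ((-(l : ℝ) + 1 / 2) * (2 : ℝ) ^ b')
              (ν / 2) ((b' : ℤ) + H.normBits α L) := by
  -- In K+3, the localization estimate accounts for 2, the factor 2^{b'} for K, and 1/ν for 1.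
  refine ⟨128 * (M + 1 : ℝ) ^ 3 * Real.exp (2 + K) + 4 * (M + 1) * (K + 3), by positivity, ?_⟩
  intro E _ _ _ H α ε ν b' l L hα hε hε1 hν hν1 hb hbK hH hL e heig he
  have hω := H.freq_pos
  have hαT : 0 ≤ α * H.period := mul_nonneg ((norm_nonneg _).trans (hα 0)) H.period_pos.le
  have hl := abs_nonneg (l : ℝ)
  have hlogε : 0 ≤ Real.log (1 / ε) := Real.log_nonneg (one_le_one_div hε hε1.le)
  have hlogν : 0 ≤ Real.log (1 / ν) := Real.log_nonneg (one_le_one_div hν hν1.le)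
  have hlog : Real.log (1 / (ε * ν)) = Real.log (1 / ε) + Real.log (1 / ν) := by
    rw [← Real.log_mul (by positivity) (by positivity), one_div_mul_one_div]
  set X := α * H.period + |(l : ℝ)| + Real.log (1 / (ε * ν)) with hXdef
  rw [hlog] at hXdef
  have hX0 : 0 ≤ X := by linarith
  have hb0 : b' ≠ 0 := by
    rintro rfl
    simp only [pow_zero, inv_one] at hb
    linarith
  have hq : (2 : ℝ) ^ b' ≤ Real.exp (K + K * X) := by
    calc (2 : ℝ) ^ b' ≤ Real.exp 1 ^ b' := by
          gcongr
          linarith [Real.add_one_le_exp 1]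
      _ = Real.exp b' := by rw [← Real.exp_nat_mul, mul_one]
      _ ≤ _ := Real.exp_le_exp.2 (by
          have : K * Real.log (1 / ε) ≤ K * X := by gcongr; linarith
          linarith)
  have hνX : 1 ≤ ν * Real.exp X := by
    have h1 : 1 / ν ≤ Real.exp X := by
      rw [← Real.exp_log (show 0 < 1 / ν by positivity)]
      exact Real.exp_le_exp.2 (by linarith)
    rwa [div_le_iff₀' hν] at h1
  set η := 4 * (M + 1 : ℝ) * L * X * Real.exp (2 + 2 * X - L / (M + 1)) with hη
  have hη0 : 0 ≤ η := by positivity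
  -- The eigenvalue error is at most ωη/2, so this is the tolerance ων/(4·2^{b'}).
  have hηlt : η < ν / (2 * 2 ^ b') := by
    have h1 := PeriodicHamiltonian.mul_exp_lt_one_of_cutoff (P := M + 1) (K := K) (L := L) (X := X)
      (by simp) hK (Nat.cast_nonneg L) hX0 hL
    have h2 : 8 * (M + 1 : ℝ) * L * X * Real.exp (2 + K + (K + 3) * X - L / (M + 1))
        = 2 * η * Real.exp (K + K * X) * Real.exp X := by
      rw [hη, show 2 + K + (K + 3) * X - (L : ℝ) / (M + 1)
        = (2 + 2 * X - L / (M + 1)) + (K + K * X) + X by ring, Real.exp_add, Real.exp_add]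
      ring
    rw [h2] at h1
    rw [lt_div_iff₀ (by positivity)]
    have h3 : 2 * η * Real.exp (K + K * X) < ν :=
      lt_of_mul_lt_mul_right (h1.trans_le hνX) (Real.exp_pos X).le
    have h4 : 2 * η * 2 ^ b' ≤ 2 * η * Real.exp (K + K * X) := by gcongr
    linarith
  have hηhalf : η ≤ 1 / 2 := by
    refine hηlt.le.trans ?_
    rw [div_le_div_iff₀ (by positivity) two_pos]
    have : (1 : ℝ) ≤ 2 ^ b' := one_le_pow₀ one_le_two
    linarith
  obtain ⟨e', he', hle⟩ := H.exists_isQuasienergy_near_eigenvalue hα heig he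
    (X := X) (by linarith) hηhalf
  refine hH.notMem_roundingIntervals hν1 hb0 he' (hle.trans_lt ?_) _
  have h5 := mul_lt_mul_of_pos_left hηlt hω
  have h6 : H.freq * (ν / (2 * 2 ^ b')) = 2 * (H.freq * (ν / (4 * 2 ^ b'))) := by
    field_simp
    norm_num
  linarith
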